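/- Let $q$ be a complex number with $0<|q|<1$. For $n\ge 0$ write $(x;p)_n=\prod_{j=0}^{n-1}(1-xp^j)$, $(x;p)_\infty=\prod_{j\ge 0}(1-xp^j)$, $(x)_n=(x;q)_n$, $(x)_\infty=(x;q)_\infty$, let $\begin{bmatrix} n\\k\end{bmatrix}=\frac{(q)_n}{(q)_{n-k}(q)_k}$ for $0\le k\le n$ and $\begin{bmatrix} n\\k\end{bmatrix}=0$ otherwise, let $\binom{n}{2}=\frac{n(n-1)}{2}$ for $n\in\mathbb Z$, and let $\delta_{i,j}$ be the Kronecker delta. Let $(\alpha_n)_{n\ge0}$, $(\beta_n)_{n\ge0}$ be complex sequences forming a Bailey pair relative to $q$, that is, $$\beta_n=\sum_{k=0}^n\frac{\alpha_k}{(q)_{n-k}(q^2)_{n+k}}\qquad(n\ge 0),$$ and let $(f_n)_{n\in\mathbb Z}$ be complex numbers with $$\alpha_n=\frac{1-q^{2n+1}}{1-q}\,f_n\quad(n\ge 0),\qquad q^nf_n=-q^{-n-1}f_{-n-1}\quad(n\in\mathbb Z).$$ Let $m\ge 1$ and $0\le a\le m$ be integers such that the series $\sum_{n\in\mathbb Z}q^{m\binom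 n2+an}f_n$ converges absolutely. Then the multiple series below converges absolutely as well, and $$\sum_{n_m,\dots,n_1\ge 0}\frac{q^{\binom{n_m+1}{2}+\cdots+\binom{n_1+1}{2}}\,(q^2;q^2)_{n_1+\delta_{a,0}}}{(q)_{n_m}}\,\beta_{n_1+\delta_{a,0}}\prod_{i=1}^{m-1}\begin{bmatrix} n_{i+1}+\delta_{a,i}\\ n_i\end{bmatrix} =\frac{(-q)_\infty}{(q)_\infty}\sum_{n\in\mathbb Z}q^{m\binom n2+an}f_n .$$ -/

import Mathlib

open scoped BigOperators

/-- The finite `q`-shifted factorial `(a; q)_n = ∏_{j=0}^{n-1} (1 - a q^j)`. -/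
noncomputable def qPoch (a q : ℂ) (n : ℕ) : ℂ :=
  ∏ j ∈ Finset.range n, (1 - a * q ^ j)

/-- The infinite `q`-shifted factorial `(a; q)_∞ = ∏_{j ≥ 0} (1 - a q^j)`
(the product converges absolutely for `‖q‖ < 1`). -/
noncomputable def qPochInf (a q : ℂ) : ℂ :=
  ∏' j : ℕ, (1 - a * q ^ j)

/-- The `q`-binomial coefficient: `(q)_n / ((q)_{n-k} (q)_k)` for `0 ≤ k ≤ n`, and `0` otherwise. -/
noncomputable def qBinom (q : ℂ) (n k : ℕ) : ℂ :=
  if k ≤ n then qPoch q q n / (qPoch q q (n - k) * qPoch q q k) else 0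

/-- `(α_n, β_n)` is a Bailey pair relative to `x` (with base `q`):
`β_n = ∑_{k=0}^n α_k / ((q)_{n-k} (xq)_{n+k})` for all `n ≥ 0`. -/
def IsBaileyPair (q x : ℂ) (α β : ℕ → ℂ) : Prop :=
  ∀ n : ℕ, β n =
    ∑ k ∈ Finset.range (n + 1), α k / (qPoch q q (n - k) * qPoch (x * q) q (n + k))

/-- The Kronecker delta `δ_{i,j}`. -/
def kdelta (i j : ℕ) : ℕ := if i = j then 1 else 0

/-- For an `m`-tuple `(n_1, …, n_m)`, stored as a function on `Fin m`, `entry n i` is `n_i` with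
the index `i` running from `1` to `m` (other values of `i` are never used). -/
def entry {m : ℕ} (n : Fin m → ℕ) (i : ℕ) : ℕ :=
  if h : 1 ≤ i ∧ i ≤ m then n ⟨i - 1, by omega⟩ else 0

/-- The summand, at `(n_1, …, n_m)`, of the multisum
`∑ q^{C(n_m+1,2) + ⋯ + C(n_1+1,2)} (q²;q²)_{n_1+δ_{a,0}} / (q)_{n_m} · β_{n_1+δ_{a,0}}
  · ∏_{i=1}^{m-1} [n_{i+1} + δ_{a,i}; n_i]`. -/
noncomputable def multisumTerm (q : ℂ) (β : ℕ → ℂ) (m a : ℕ) (n : Fin m → ℕ) : ℂ :=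
  q ^ (∑ i ∈ Finset.Icc 1 m, (entry n i + 1).choose 2)
      * qPoch (q ^ 2) (q ^ 2) (entry n 1 + kdelta a 0) / qPoch q q (entry n m)
    * β (entry n 1 + kdelta a 0)
    * ∏ i ∈ Finset.Icc 1 (m - 1), qBinom q (entry n (i + 1) + kdelta a i) (entry n i)

/-- The summand `q^{m C(n,2) + a n} f_n`, `n ∈ ℤ`, of the bilateral series; here
`C(n,2) = n (n - 1) / 2`, an exact division in `ℤ`. -/
noncomputable def thetaTerm (q : ℂ) (f : ℤ → ℂ) (m a : ℕ) (n : ℤ) : ℂ :=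
  q ^ ((m : ℤ) * (n * (n - 1) / 2) + (a : ℤ) * n) * f n

open Filter Topology

/-! Put B_N(α) = (q²;q²)_N β_N (`scaledBeta`). Bailey's lemma relative to q with ρ₁ = -q, ρ₂ → ∞
takes the form Σ_n q^{C(n+1,2)} [N; n] B_n(α) = B_N(q^{C(k+1,2)} α_k) (`sum_scaledBeta`), a
consequence of q-Chu–Vandermonde. Its limit N → ∞ evaluates the sum over n_m (`hasSum_scaledBeta`).

The multisum iterates this step, starting with n_1. Each step multiplies f_k by q^{C(k,2)+k} and
lowers m and a by one. If a < m, after a steps the Kronecker delta asks for B at N+1 instead of N.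
The factor 1 - q^{2k+1} in α allows B_{N+1} to be rewritten as B_N of a new sequence
(`scaledBeta_succ`), and the other m - a steps meet no delta. The shift turns their exponents
C(k+1,2) back into C(k,2), so that f_k carries q^{mC(k,2)+ak}, together with a factor 1 -
q^{(m+1-a)(2k+1)}. The reflection f_n ↔ f_{-n-1} folds the bilateral series into this same one-sided
series.

Summing n_1 first requires absolute convergence. `summable_chainWeight` proves it by the same
induction, resting on the estimate `sum_pow_mul_sum_le`. -/

/-! ### q-shifted factorials, q-binomials and q-Chu–Vandermonde -/

theorem qPoch_zero (x q : ℂ) : qPoch x q 0 = 1 := by simp [qPoch]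

theorem qPoch_succ (x q : ℂ) (n : ℕ) : qPoch x q (n + 1) = qPoch x q n * (1 - x * q ^ n) :=
  Finset.prod_range_succ _ _

theorem qPoch_succ' (x q : ℂ) (n : ℕ) : qPoch x q (n + 1) = (1 - x) * qPoch (x * q) q n := by
  unfold qPoch
  rw [Finset.prod_range_succ', mul_comm]
  simp [pow_succ', mul_assoc]

theorem qPoch_add (x q : ℂ) (m n : ℕ) :
    qPoch x q (m + n) = qPoch x q m * qPoch (x * q ^ m) q n := by
  unfold qPoch
  rw [Finset.prod_range_add]
  simp [pow_add, mul_assoc]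

theorem qPoch_sq (q : ℂ) (n : ℕ) :
    qPoch (q ^ 2) (q ^ 2) n = qPoch q q n * qPoch (-q) q n := by
  unfold qPoch
  rw [← Finset.prod_mul_distrib]
  exact Finset.prod_congr rfl fun j _ => by ring

theorem one_sub_pow_ne_zero {q : ℂ} (hq1 : ‖q‖ < 1) (n : ℕ) : 1 - q ^ (n + 1) ≠ 0 := by
  intro h
  have h1 : ‖q ^ (n + 1)‖ < 1 := by
    rw [norm_pow]; exact pow_lt_one₀ (norm_nonneg _) hq1 (by omega)
  rw [← sub_eq_zero.mp h] at h1
  simp at h1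

theorem qPoch_ne_zero {q : ℂ} (hq1 : ‖q‖ < 1) {x : ℂ} (hx : ‖x‖ < 1) (n : ℕ) :
    qPoch x q n ≠ 0 := by
  refine Finset.prod_ne_zero_iff.mpr fun j _ h => ?_
  have h1 : ‖x * q ^ j‖ < 1 := by
    rw [norm_mul, norm_pow]
    exact (mul_le_of_le_one_right (norm_nonneg _)
      (pow_le_one₀ (norm_nonneg _) hq1.le)).trans_lt hx
  rw [← sub_eq_zero.mp h] at h1
  simp at h1

theorem qPoch_self_ne_zero {q : ℂ} (hq1 : ‖q‖ < 1) (n : ℕ) : qPoch q q n ≠ 0 :=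
  qPoch_ne_zero hq1 hq1 n

theorem one_sub_mul_qPoch (q : ℂ) (n : ℕ) :
    (1 - q) * qPoch (q * q) q n = qPoch q q (n + 1) := (qPoch_succ' q q n).symm

theorem qBinom_of_le {q : ℂ} {n k : ℕ} (h : k ≤ n) :
    qBinom q n k = qPoch q q n / (qPoch q q (n - k) * qPoch q q k) := if_pos h

theorem qBinom_of_lt {q : ℂ} {n k : ℕ} (h : n < k) : qBinom q n k = 0 :=
  if_neg (by omega)

theorem qBinom_zero_right {q : ℂ} (hq1 : ‖q‖ < 1) (n : ℕ) : qBinom q n 0 = 1 := by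
  rw [qBinom_of_le (Nat.zero_le _), qPoch_zero, Nat.sub_zero, mul_one,
    div_self (qPoch_self_ne_zero hq1 n)]

theorem qBinom_succ_succ {q : ℂ} (hq1 : ‖q‖ < 1) (n k : ℕ) :
    qBinom q (n + 1) (k + 1) = qBinom q n (k + 1) + q ^ (n - k) * qBinom q n k := by
  rcases lt_trichotomy n k with h | rfl | h
  · rw [qBinom_of_lt h, qBinom_of_lt (by omega), qBinom_of_lt (by omega)]; simp
  · have h1 := qPoch_self_ne_zero hq1 n
    have h2 := qPoch_self_ne_zero hq1 (n + 1)
    rw [qBinom_of_lt (Nat.lt_succ_self n), qBinom_of_le le_rfl, qBinom_of_le le_rfl]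
    simp only [Nat.sub_self, qPoch_zero]
    field_simp
    simp
  · obtain ⟨d, rfl⟩ := Nat.exists_eq_add_of_lt h
    rw [qBinom_of_le (by omega), qBinom_of_le (by omega), qBinom_of_le (by omega)]
    have e1 : k + d + 1 + 1 - (k + 1) = d + 1 := by omega
    have e2 : k + d + 1 - (k + 1) = d := by omega
    have e3 : k + d + 1 - k = d + 1 := by omega
    rw [e1, e2, e3, qPoch_succ q q (k + d + 1), qPoch_succ q q d, qPoch_succ q q k]
    have h1 := qPoch_self_ne_zero hq1 d
    have h2 := qPoch_self_ne_zero hq1 k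
    have h3 := one_sub_pow_ne_zero hq1 d
    have h4 := one_sub_pow_ne_zero hq1 k
    rw [pow_succ'] at h3 h4
    field_simp
    ring

/-- The `q`-Chu–Vandermonde summation, in denominator-free form. -/
theorem qChuVandermonde {q : ℂ} (hq1 : ‖q‖ < 1) (d : ℂ) (M : ℕ) (b : ℂ) :
    ∑ j ∈ Finset.range (M + 1), qBinom q M j * qPoch b q j * (-d) ^ j * q ^ (j.choose 2)
      * qPoch (b * d * q ^ j) q (M - j) = qPoch d q M := by
  -- Pascal's rule writes the sum for M + 1 as (1 - bdq^M) times the sum for b minus dq^M(1 - b)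
  -- times the sum for bq, so b has to vary. The coefficients add up to 1 - dq^M.
  induction M generalizing b with
  | zero => simp [qPoch_zero, qBinom_zero_right hq1]
  | succ M ih =>
    have key : ∀ j ∈ Finset.range (M + 1),
        qBinom q (M + 1) (j + 1) * qPoch b q (j + 1) * (-d) ^ (j + 1) * q ^ ((j + 1).choose 2)
          * qPoch (b * d * q ^ (j + 1)) q (M + 1 - (j + 1))
        = qBinom q M (j + 1) * qPoch b q (j + 1) * (-d) ^ (j + 1) * q ^ ((j + 1).choose 2)
          * qPoch (b * d * q ^ (j + 1)) q (M + 1 - (j + 1))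
          + -(d * q ^ M * (1 - b)) * (qBinom q M j * qPoch (b * q) q j * (-d) ^ j
            * q ^ (j.choose 2) * qPoch (b * q * d * q ^ j) q (M - j)) := by
      intro j hj
      have hj' : j ≤ M := by simpa [Nat.lt_succ_iff] using hj
      obtain ⟨e, rfl⟩ := Nat.exists_eq_add_of_le hj'
      have e1 : j + e + 1 - (j + 1) = e := by omega
      have e2 : j + e - j = e := by omega
      have e3 : (j + 1).choose 2 = j + j.choose 2 := by
        rw [Nat.choose_succ_succ' j 1, Nat.choose_one_right]
      have e4 : b * q * d * q ^ j = b * d * q ^ (j + 1) := by ring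
      rw [qBinom_succ_succ hq1, e1, e2, e3, qPoch_succ' b q j, e4]
      ring
    rw [Finset.sum_range_succ', Finset.sum_congr rfl key, Finset.sum_add_distrib,
      ← Finset.mul_sum, ih (b * q), add_right_comm]
    have h0 : qBinom q (M + 1) 0 = qBinom q M 0 := by
      rw [qBinom_zero_right hq1, qBinom_zero_right hq1]
    rw [h0, ← Finset.sum_range_succ' (fun j => qBinom q M j * qPoch b q j * (-d) ^ j
      * q ^ (j.choose 2) * qPoch (b * d * q ^ j) q (M + 1 - j)), Finset.sum_range_succ,
      qBinom_of_lt (Nat.lt_succ_self M)]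
    have h2 : ∀ j ∈ Finset.range (M + 1), qBinom q M j * qPoch b q j * (-d) ^ j
        * q ^ (j.choose 2) * qPoch (b * d * q ^ j) q (M + 1 - j)
        = (1 - b * d * q ^ M) * (qBinom q M j * qPoch b q j * (-d) ^ j
        * q ^ (j.choose 2) * qPoch (b * d * q ^ j) q (M - j)) := by
      intro j hj
      have hj' : j ≤ M := by simpa [Nat.lt_succ_iff] using hj
      obtain ⟨e, rfl⟩ := Nat.exists_eq_add_of_le hj'
      have e1 : j + e + 1 - j = e + 1 := by omega
      have e2 : j + e - j = e := by omega
      rw [e1, e2, qPoch_succ]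
      ring
    rw [Finset.sum_congr rfl h2, ← Finset.mul_sum, ih b, qPoch_succ d q M]
    ring

/-! ### The Bailey chain step -/

/-- The kernel `1 / ((q)_{n-k} (q²)_{n+k})` of Bailey pairs relative to `q`, extended by zero. -/
noncomputable def baileyKernel (q : ℂ) (n k : ℕ) : ℂ :=
  if k ≤ n then 1 / (qPoch q q (n - k) * qPoch (q * q) q (n + k)) else 0

theorem baileyKernel_of_lt {q : ℂ} {n k : ℕ} (h : n < k) : baileyKernel q n k = 0 :=
  if_neg (by omega)

theorem baileyKernel_add {q : ℂ} (k d : ℕ) :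
    baileyKernel q (k + d) k = 1 / (qPoch q q d * qPoch (q * q) q (2 * k + d)) := by
  rw [baileyKernel, if_pos (by omega)]
  congr 3 <;> omega

theorem choose_two_add (k j : ℕ) :
    (k + j + 1).choose 2 = (k + 1).choose 2 + (k + 1) * j + j.choose 2 := by
  induction j with
  | zero => simp
  | succ j ih =>
    rw [← add_assoc, Nat.choose_succ_succ' (k + j + 1) 1, ih, Nat.choose_succ_succ' j 1,
      Nat.choose_one_right, Nat.choose_one_right]
    ring

theorem norm_sq_lt_one {q : ℂ} (hq1 : ‖q‖ < 1) : ‖q * q‖ < 1 := by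
  rw [norm_mul]; exact mul_lt_one_of_nonneg_of_lt_one_left (norm_nonneg _) hq1 hq1.le

/-- Bailey's lemma on a single α_k. With n = k + j and N = k + M it is q-Chu–Vandermonde at b = d =
-q^{k+1}, since bdq^j = q²·q^{2k+j} continues the factor (q²;q)_{2k+j}. -/
theorem sum_baileyKernel {q : ℂ} (hq1 : ‖q‖ < 1) (N k : ℕ) :
    ∑ n ∈ Finset.range (N + 1), q ^ ((n + 1).choose 2) * qPoch (-q) q n / qPoch q q (N - n)
      * baileyKernel q n k = q ^ ((k + 1).choose 2) * qPoch (-q) q N * baileyKernel q N k := by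
  rcases lt_or_ge N k with h | h
  · rw [baileyKernel_of_lt h, mul_zero]
    refine Finset.sum_eq_zero fun n hn => ?_
    rw [baileyKernel_of_lt (by have := Finset.mem_range.mp hn; omega), mul_zero]
  obtain ⟨M, rfl⟩ := Nat.exists_eq_add_of_le h
  rw [add_assoc, Finset.sum_range_add, Finset.sum_eq_zero, zero_add]
  swap
  · intro n hn
    rw [baileyKernel_of_lt (by simpa using hn), mul_zero]
  have hV := qChuVandermonde hq1 (-q ^ (k + 1)) M (-q ^ (k + 1))
  have h1 : ∀ n, qPoch q q n ≠ 0 := qPoch_self_ne_zero hq1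
  have h2 : ∀ n, qPoch (q * q) q n ≠ 0 := qPoch_ne_zero hq1 (norm_sq_lt_one hq1)
  have ek : -q * q ^ k = -q ^ (k + 1) := by ring
  rw [baileyKernel_add, qPoch_add (-q) q k M, ek, ← hV, Finset.mul_sum, Finset.mul_sum,
    Finset.sum_mul]
  refine Finset.sum_congr rfl fun j hj => ?_
  have hj' : j ≤ M := by simpa [Nat.lt_succ_iff] using hj
  obtain ⟨e, rfl⟩ := Nat.exists_eq_add_of_le hj'
  have e1 : k + (j + e) - (k + j) = e := by omega
  have e2 : j + e - j = e := by omega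
  have e3 : 2 * k + (j + e) = (2 * k + j) + e := by ring
  have e4 : -q ^ (k + 1) * -q ^ (k + 1) * q ^ j = q * q * q ^ (2 * k + j) := by ring
  rw [baileyKernel_add, qBinom_of_le hj', e1, e2, e3, qPoch_add (q * q) q (2 * k + j) e,
    e4, qPoch_add (-q) q k j, ek, choose_two_add]
  have h3 : qPoch (q * q * q ^ (2 * k + j)) q e ≠ 0 := by
    intro h0
    apply h2 (2 * k + j + e)
    rw [qPoch_add, h0, mul_zero]
  generalize qPoch (q * q * q ^ (2 * k + j)) q e = y at *
  have := h1 j; have := h1 e; have := h1 (j + e); have := h2 (2 * k + j)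
  field_simp
  ring

/-- `(q²;q²)_N β_N`, for the sequence `β` that forms a Bailey pair relative to `q` with `α`. -/
noncomputable def scaledBeta (q : ℂ) (α : ℕ → ℂ) (N : ℕ) : ℂ :=
  qPoch q q N * qPoch (-q) q N * ∑ k ∈ Finset.range (N + 1), α k * baileyKernel q N k

theorem IsBaileyPair.scaledBeta_eq {q : ℂ} {α β : ℕ → ℂ} (h : IsBaileyPair q q α β) (N : ℕ) :
    qPoch (q ^ 2) (q ^ 2) N * β N = scaledBeta q α N := by
  rw [qPoch_sq, h N, scaledBeta]
  congr 1
  refine Finset.sum_congr rfl fun k hk => ?_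
  rw [baileyKernel, if_pos (by simpa [Nat.lt_succ_iff] using hk), mul_one_div]

theorem sum_baileyKernel_extend (q : ℂ) (α : ℕ → ℂ) {n N : ℕ} (h : n ≤ N) :
    ∑ k ∈ Finset.range (n + 1), α k * baileyKernel q n k
      = ∑ k ∈ Finset.range (N + 1), α k * baileyKernel q n k := by
  refine Finset.sum_subset (Finset.range_subset_range.mpr (by omega)) fun k _ hk => ?_
  rw [baileyKernel_of_lt (by simpa using hk), mul_zero]

/-- A Bailey chain step, `α_k ↦ q^{k(k+1)/2} α_k`, before normalisation. -/
theorem sum_beta_step {q : ℂ} (hq1 : ‖q‖ < 1) (α : ℕ → ℂ) (N : ℕ) :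
    ∑ n ∈ Finset.range (N + 1), q ^ ((n + 1).choose 2) * qPoch (-q) q n / qPoch q q (N - n)
      * ∑ k ∈ Finset.range (n + 1), α k * baileyKernel q n k
    = qPoch (-q) q N * ∑ k ∈ Finset.range (N + 1),
        q ^ ((k + 1).choose 2) * α k * baileyKernel q N k := by
  have h : ∀ n ∈ Finset.range (N + 1),
      q ^ ((n + 1).choose 2) * qPoch (-q) q n / qPoch q q (N - n)
        * ∑ k ∈ Finset.range (n + 1), α k * baileyKernel q n k
      = ∑ k ∈ Finset.range (N + 1), α k * (q ^ ((n + 1).choose 2) * qPoch (-q) q n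
        / qPoch q q (N - n) * baileyKernel q n k) := by
    intro n hn
    rw [sum_baileyKernel_extend q α (by simpa [Nat.lt_succ_iff] using hn), Finset.mul_sum]
    exact Finset.sum_congr rfl fun k _ => by ring
  rw [Finset.sum_congr rfl h, Finset.sum_comm, Finset.mul_sum]
  refine Finset.sum_congr rfl fun k _ => ?_
  rw [← Finset.mul_sum, sum_baileyKernel hq1]
  ring

/-- Scaling β_N by (q²;q²)_N = (q)_N (-q)_N makes the chain step an exact q-binomial transform, the
shape of each inner sum of the multisum. -/
theorem sum_scaledBeta {q : ℂ} (hq1 : ‖q‖ < 1) (α : ℕ → ℂ) (N : ℕ) :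
    ∑ n ∈ Finset.range (N + 1), q ^ ((n + 1).choose 2) * qBinom q N n * scaledBeta q α n
      = scaledBeta q (fun k => q ^ ((k + 1).choose 2) * α k) N := by
  rw [scaledBeta, mul_assoc, ← sum_beta_step hq1 α N, Finset.mul_sum]
  refine Finset.sum_congr rfl fun n hn => ?_
  rw [qBinom_of_le (by simpa [Nat.lt_succ_iff] using hn), scaledBeta]
  have := qPoch_self_ne_zero hq1 n
  field_simp

/-! ### Shifting N to N + 1 -/

theorem one_div_qPoch {q : ℂ} (hq1 : ‖q‖ < 1) {x : ℂ} (hx : ‖x‖ < 1) (n : ℕ) :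
    1 / qPoch x q n = (1 - x * q ^ n) * (1 / qPoch x q (n + 1)) := by
  have h := qPoch_ne_zero hq1 hx (n + 1)
  rw [qPoch_succ] at h ⊢
  have h1 := left_ne_zero_of_mul h
  have h2 := right_ne_zero_of_mul h
  generalize 1 - x * q ^ n = y at *
  field_simp

theorem baileyKernel_add' {q : ℂ} (k d : ℕ) :
    baileyKernel q (k + d) k = 1 / qPoch q q d * (1 / qPoch (q * q) q (2 * k + d)) := by
  rw [baileyKernel_add, one_div_mul_one_div]

/-- Over a common denominator this is (1 - q^{2k+3})(1 - q^{2N+2}) = (1 - q^{N+k+2})(1 - q^{N+k+3})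
- q^{2k+3}(1 - q^{N-k})(1 - q^{N-k-1}). The last product vanishes for N - k ≤ 1, in agreement with
the extension of the kernel by zero. -/
theorem baileyKernel_shift {q : ℂ} (hq1 : ‖q‖ < 1) (N k : ℕ) :
    (1 - q ^ (2 * k + 3)) * (1 - q ^ (2 * N + 2)) * baileyKernel q (N + 1) (k + 1)
      = baileyKernel q N k - q ^ (2 * k + 3) * baileyKernel q N (k + 2) := by
  have h1 := one_div_qPoch hq1 hq1
  have h2 := one_div_qPoch hq1 (norm_sq_lt_one hq1)
  rcases lt_or_ge N k with h | h
  · rw [baileyKernel_of_lt h, baileyKernel_of_lt (by omega), baileyKernel_of_lt (by omega)]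
    simp
  obtain ⟨d, rfl⟩ := Nat.exists_eq_add_of_le h
  rw [show k + d + 1 = k + 1 + d by ring, baileyKernel_add', baileyKernel_add',
    show 2 * (k + 1) + d = 2 * k + d + 1 + 1 by ring, h2 (2 * k + d), h2 (2 * k + d + 1)]
  rcases d with _ | _ | d
  · rw [baileyKernel_of_lt (by omega), qPoch_zero]
    ring
  · rw [baileyKernel_of_lt (by omega)]
    ring
  · rw [show k + (d + 1 + 1) = k + 2 + d by ring, baileyKernel_add',
      show 2 * (k + 2) + d = 2 * k + (d + 1 + 1) + 1 + 1 by ring, h1 d, h1 (d + 1)]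
    ring

/-- The case k = -1 of the previous relation: the formula for the kernel takes the same value at k =
-1 and k = 0. -/
theorem baileyKernel_shift_zero {q : ℂ} (hq1 : ‖q‖ < 1) (N : ℕ) :
    (1 - q) * (1 - q ^ (2 * N + 2)) * baileyKernel q (N + 1) 0
      = baileyKernel q N 0 - q * baileyKernel q N 1 := by
  have h1 := one_div_qPoch hq1 hq1
  have h2 := one_div_qPoch hq1 (norm_sq_lt_one hq1)
  have e := baileyKernel_add' (q := q) 0 (N + 1)
  have e' := baileyKernel_add' (q := q) 0 N
  rw [zero_add, mul_zero, zero_add] at e e'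
  rw [e, e', h2 N, h1 N]
  rcases N with _ | N
  · rw [baileyKernel_of_lt (by omega)]
    ring
  · rw [add_comm N 1, baileyKernel_add', add_comm 1 N,
      show 2 * 1 + N = N + 1 + 1 by ring, h1 N, h1 (N + 1)]
    ring

/-- The sequence `α` attached to `β_{n+1} (1 - q^{2n+2})` when `α_k = (1 - q^{2k+1})/(1-q) F_k`. -/
noncomputable def shiftedAlpha (q : ℂ) (F : ℕ → ℂ) : ℕ → ℂ
  | 0 => (F 1 + F 0) / (1 - q)
  | j + 1 => (F (j + 2) - q ^ (2 * j + 1) * F j) / (1 - q)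

/-- The factor 1 - q^{2k+1} of α and the factor 1 - q^{2N+2} of (q²;q²)_{N+1} are those of
`baileyKernel_shift`. Regrouping by the kernel at level N gives the new sequence, whose entry at 0
collects both F 0 and F 1. -/
theorem scaledBeta_succ {q : ℂ} (hq1 : ‖q‖ < 1) (F : ℕ → ℂ) (N : ℕ) :
    scaledBeta q (fun k => (1 - q ^ (2 * k + 1)) / (1 - q) * F k) (N + 1)
      = scaledBeta q (shiftedAlpha q F) N := by
  have hq : 1 - q ≠ 0 := by simpa using one_sub_pow_ne_zero hq1 0
  unfold scaledBeta
  rw [qPoch_succ, qPoch_succ, show qPoch q q N * (1 - q * q ^ N)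
    * (qPoch (-q) q N * (1 - -q * q ^ N)) = qPoch q q N * qPoch (-q) q N * (1 - q ^ (2 * N + 2))
    by ring, mul_assoc]
  congr 1
  rw [Finset.mul_sum, Finset.sum_range_succ']
  have hS : ∀ k, (1 - q ^ (2 * N + 2)) * ((1 - q ^ (2 * (k + 1) + 1)) / (1 - q) * F (k + 1)
      * baileyKernel q (N + 1) (k + 1)) = F (k + 1) / (1 - q) * baileyKernel q N k
        - F (k + 1) / (1 - q) * q ^ (2 * k + 3) * baileyKernel q N (k + 2) := fun k => by
    have := baileyKernel_shift hq1 N k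
    linear_combination F (k + 1) / (1 - q) * this
  have h0 : (1 - q ^ (2 * N + 2)) * ((1 - q ^ (2 * 0 + 1)) / (1 - q) * F 0
      * baileyKernel q (N + 1) 0) = F 0 / (1 - q) * baileyKernel q N 0
        - F 0 / (1 - q) * q * baileyKernel q N 1 := by
    have := baileyKernel_shift_zero hq1 N
    linear_combination F 0 / (1 - q) * this
  rw [h0, Finset.sum_congr rfl fun k _ => hS k, Finset.sum_sub_distrib]
  have hA : ∑ k ∈ Finset.range (N + 1), F (k + 1) / (1 - q) * q ^ (2 * k + 3)
        * baileyKernel q N (k + 2) + F 0 / (1 - q) * q * baileyKernel q N 1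
      = ∑ k ∈ Finset.range N, F k / (1 - q) * q ^ (2 * k + 1) * baileyKernel q N (k + 1) := by
    have h1 := Finset.sum_range_succ'
      (fun k => F k / (1 - q) * q ^ (2 * k + 1) * baileyKernel q N (k + 1)) (N + 1)
    rw [Finset.sum_range_succ, Finset.sum_range_succ, baileyKernel_of_lt (k := N + 1 + 1) (by omega),
      baileyKernel_of_lt (k := N + 1) (by omega)] at h1
    simp only [mul_zero, add_zero, zero_add, pow_one] at h1
    rw [h1]
    rfl
  rw [Finset.sum_range_succ' (fun k => shiftedAlpha q F k * baileyKernel q N k),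
    Finset.sum_range_succ' (fun k => F (k + 1) / (1 - q) * baileyKernel q N k)]
  have hB : ∑ k ∈ Finset.range N, shiftedAlpha q F (k + 1) * baileyKernel q N (k + 1)
      = ∑ k ∈ Finset.range N, F (k + 1 + 1) / (1 - q) * baileyKernel q N (k + 1)
        - ∑ k ∈ Finset.range N, F k / (1 - q) * q ^ (2 * k + 1) * baileyKernel q N (k + 1) := by
    rw [← Finset.sum_sub_distrib]
    exact Finset.sum_congr rfl fun k _ => by rw [shiftedAlpha]; ring
  rw [hB, ← hA, shiftedAlpha]
  ring

/-! ### Limits, uniform bounds and the limiting chain step -/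

theorem summable_norm_mul_pow {q : ℂ} (hq1 : ‖q‖ < 1) (x : ℂ) :
    Summable fun j : ℕ => ‖-(x * q ^ j)‖ := by
  simp only [norm_neg, norm_mul, norm_pow]
  exact (summable_geometric_of_lt_one (norm_nonneg _) hq1).mul_left _

theorem tendsto_qPoch {q : ℂ} (hq1 : ‖q‖ < 1) (x : ℂ) :
    Tendsto (qPoch x q) atTop (𝓝 (qPochInf x q)) := by
  have h := (multipliable_one_add_of_summable (summable_norm_mul_pow hq1 x)).hasProd.tendsto_prod_nat
  simp only [← sub_eq_add_neg] at h
  exact h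

theorem qPochInf_ne_zero {q : ℂ} (hq1 : ‖q‖ < 1) {x : ℂ} (hx : ‖x‖ < 1) : qPochInf x q ≠ 0 := by
  have h := tprod_one_add_ne_zero_of_summable (f := fun j : ℕ => -(x * q ^ j)) (fun j h => ?_)
    (summable_norm_mul_pow hq1 x)
  · simp only [← sub_eq_add_neg] at h
    exact h
  · rw [← sub_eq_add_neg] at h
    apply qPoch_ne_zero hq1 hx (j + 1)
    rw [qPoch_succ, h, mul_zero]

theorem exists_norm_le_of_tendsto {u : ℕ → ℂ} {l : ℂ} (h : Tendsto u atTop (𝓝 l)) :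
    ∃ C : ℝ, 0 ≤ C ∧ ∀ n, ‖u n‖ ≤ C := by
  obtain ⟨C, hC⟩ := h.norm.bddAbove_range
  exact ⟨C, (norm_nonneg _).trans (hC ⟨0, rfl⟩), fun n => hC ⟨n, rfl⟩⟩

theorem tendsto_inv_qPoch {q : ℂ} (hq1 : ‖q‖ < 1) {x : ℂ} (hx : ‖x‖ < 1) :
    Tendsto (fun n => (qPoch x q n)⁻¹) atTop (𝓝 (qPochInf x q)⁻¹) :=
  (tendsto_qPoch hq1 x).inv₀ (qPochInf_ne_zero hq1 hx)

theorem exists_norm_qPoch_le {q : ℂ} (hq1 : ‖q‖ < 1) (x : ℂ) :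
    ∃ C : ℝ, 0 ≤ C ∧ ∀ n, ‖qPoch x q n‖ ≤ C :=
  exists_norm_le_of_tendsto (tendsto_qPoch hq1 x)

theorem exists_norm_inv_qPoch_le {q : ℂ} (hq1 : ‖q‖ < 1) {x : ℂ} (hx : ‖x‖ < 1) :
    ∃ C : ℝ, 0 ≤ C ∧ ∀ n, ‖(qPoch x q n)⁻¹‖ ≤ C :=
  exists_norm_le_of_tendsto (tendsto_inv_qPoch hq1 hx)

theorem exists_norm_qBinom_le {q : ℂ} (hq1 : ‖q‖ < 1) :
    ∃ C : ℝ, 0 ≤ C ∧ ∀ n k, ‖qBinom q n k‖ ≤ C := by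
  obtain ⟨C, hC, h⟩ := exists_norm_qPoch_le hq1 q
  obtain ⟨D, hD, h'⟩ := exists_norm_inv_qPoch_le hq1 hq1
  refine ⟨C * (D * D), by positivity, fun n k => ?_⟩
  rw [qBinom]
  split_ifs
  · rw [div_eq_mul_inv, mul_inv, norm_mul, norm_mul]
    exact mul_le_mul (h _) (mul_le_mul (h' _) (h' _) (norm_nonneg _) hD) (by positivity) hC
  · rw [norm_zero]; positivity

theorem exists_norm_baileyKernel_le {q : ℂ} (hq1 : ‖q‖ < 1) :
    ∃ C : ℝ, 0 ≤ C ∧ ∀ n k, ‖baileyKernel q n k‖ ≤ C := by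
  obtain ⟨C, hC, h⟩ := exists_norm_inv_qPoch_le hq1 hq1
  obtain ⟨D, hD, h'⟩ := exists_norm_inv_qPoch_le hq1 (norm_sq_lt_one hq1)
  refine ⟨C * D, by positivity, fun n k => ?_⟩
  rw [baileyKernel]
  split_ifs
  · rw [one_div, mul_inv, norm_mul]
    exact mul_le_mul (h _) (h' _) (norm_nonneg _) hC
  · rw [norm_zero]; positivity

theorem exists_norm_scaledBeta_le {q : ℂ} (hq1 : ‖q‖ < 1) :
    ∃ C : ℝ, 0 ≤ C ∧ ∀ (α : ℕ → ℂ) N,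
      ‖scaledBeta q α N‖ ≤ ∑ k ∈ Finset.range (N + 1), C * ‖α k‖ := by
  obtain ⟨C, hC, h⟩ := exists_norm_qPoch_le hq1 q
  obtain ⟨D, hD, h'⟩ := exists_norm_qPoch_le hq1 (-q)
  obtain ⟨E, hE, h''⟩ := exists_norm_baileyKernel_le hq1
  refine ⟨C * D * E, by positivity, fun α N => ?_⟩
  rw [scaledBeta, Finset.mul_sum]
  refine norm_sum_le_of_le _ fun k _ => ?_
  rw [norm_mul, norm_mul, norm_mul]
  calc _ ≤ C * D * (‖α k‖ * E) := by gcongr <;> apply_assumption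
    _ = _ := by ring

/-- Tannery's theorem, by dominated convergence after extending the terms by zero beyond N. -/
theorem tendsto_sum_range_mul {x : ℕ → ℂ} (hx : Summable fun k => ‖x k‖) {c : ℕ → ℕ → ℂ} {C : ℝ}
    (hc : ∀ N k, ‖c N k‖ ≤ C) {l : ℂ} (hl : ∀ k, Tendsto (fun N => c N k) atTop (𝓝 l)) :
    Tendsto (fun N => ∑ k ∈ Finset.range (N + 1), x k * c N k) atTop (𝓝 ((∑' k, x k) * l)) := by
  have h := tendsto_tsum_of_dominated_convergence (𝓕 := atTop)
    (f := fun N k => if k ∈ Finset.range (N + 1) then x k * c N k else 0)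
    (g := fun k => x k * l) (bound := fun k => ‖x k‖ * C) (hx.mul_right C) (fun k => ?_) ?_
  · rw [tsum_mul_right] at h
    refine h.congr fun N => ?_
    rw [tsum_eq_sum (s := Finset.range (N + 1)) fun k hk => if_neg hk]
    exact Finset.sum_congr rfl fun k hk => if_pos hk
  · refine ((hl k).const_mul (x k)).congr' ?_
    filter_upwards [eventually_ge_atTop k] with N hN
    rw [if_pos (Finset.mem_range.mpr (by omega))]
  · refine Eventually.of_forall fun N k => ?_
    split_ifs
    · rw [norm_mul]; exact mul_le_mul_of_nonneg_left (hc N k) (norm_nonneg _)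
    · rw [norm_zero]
      exact mul_nonneg (norm_nonneg _) ((norm_nonneg _).trans (hc 0 0))

/-- After exchanging the sums, A_k is weighted by the tail Σ_{n≥k} r^{C(n+1,2)}, which a geometric
series of ratio r dominates. -/
theorem sum_pow_mul_sum_le {r : ℝ} (hr0 : 0 ≤ r) (hr1 : r < 1) {A : ℕ → ℝ} (hA : ∀ k, 0 ≤ A k)
    (N : ℕ) :
    ∑ n ∈ Finset.range (N + 1), r ^ ((n + 1).choose 2) * ∑ k ∈ Finset.range (n + 1), A k
      ≤ (1 - r)⁻¹ * ∑ k ∈ Finset.range (N + 1), r ^ ((k + 1).choose 2) * A k := by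
  have hD : (1 - r)⁻¹ * (1 - r) = 1 := inv_mul_cancel₀ (by linarith)
  have hD0 : 0 ≤ (1 - r)⁻¹ := inv_nonneg.mpr (by linarith)
  set D := (1 - r)⁻¹
  have hS : ∀ N, 0 ≤ ∑ k ∈ Finset.range (N + 1), A k := fun N =>
    Finset.sum_nonneg fun k _ => hA k
  -- The added term bounds the part of the tail beyond N, which makes the induction close.
  suffices h : ∑ n ∈ Finset.range (N + 1), r ^ ((n + 1).choose 2)
      * ∑ k ∈ Finset.range (n + 1), A k
      + D * r ^ ((N + 2).choose 2) * ∑ k ∈ Finset.range (N + 1), A k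
      ≤ D * ∑ k ∈ Finset.range (N + 1), r ^ ((k + 1).choose 2) * A k by
    have := mul_nonneg (mul_nonneg hD0 (pow_nonneg hr0 ((N + 2).choose 2))) (hS N)
    linarith
  induction N with
  | zero =>
    simp
    have : D * A 0 - D * r * A 0 = A 0 := by linear_combination A 0 * hD
    linarith
  | succ N ih =>
    rw [Finset.sum_range_succ, Finset.sum_range_succ (fun k => r ^ ((k + 1).choose 2) * A k)]
    have hp : r ^ ((N + 2).choose 2) + D * r ^ ((N + 3).choose 2) ≤ D * r ^ ((N + 2).choose 2) := by
      rw [show (N + 3).choose 2 = (N + 2).choose 2 + (N + 2) by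
        rw [Nat.choose_succ_succ' (N + 2) 1, Nat.choose_one_right, add_comm], pow_add]
      have h1 : r ^ (N + 2) ≤ r := pow_le_of_le_one hr0 hr1.le (by omega)
      have h2 : 0 ≤ r ^ ((N + 2).choose 2) := pow_nonneg hr0 _
      have h3 := mul_le_mul_of_nonneg_left h1 (mul_nonneg hD0 h2)
      have h4 : r ^ ((N + 2).choose 2) = D * r ^ ((N + 2).choose 2)
          - D * r ^ ((N + 2).choose 2) * r := by
        linear_combination (-r ^ ((N + 2).choose 2)) * hD
      linarith
    have h5 := mul_le_mul_of_nonneg_right hp (hS (N + 1))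
    rw [add_mul, Finset.sum_range_succ A (N + 1), mul_add (D * _)] at h5
    rw [Finset.sum_range_succ A (N + 1)]
    simp only [add_assoc, Nat.reduceAdd] at *
    linarith

theorem summable_pow_mul_sum {r : ℝ} (hr0 : 0 ≤ r) (hr1 : r < 1) {A : ℕ → ℝ} (hA : ∀ k, 0 ≤ A k)
    (hs : Summable fun k => r ^ ((k + 1).choose 2) * A k) :
    Summable fun n => r ^ ((n + 1).choose 2) * ∑ k ∈ Finset.range (n + 1), A k := by
  have h0 : ∀ n, 0 ≤ r ^ ((n + 1).choose 2) * ∑ k ∈ Finset.range (n + 1), A k := fun n =>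
    mul_nonneg (pow_nonneg hr0 _) (Finset.sum_nonneg fun k _ => hA k)
  refine summable_of_sum_range_le (c := (1 - r)⁻¹ * ∑' k, r ^ ((k + 1).choose 2) * A k) h0
    fun n => ?_
  refine (Finset.sum_le_sum_of_subset_of_nonneg
    (Finset.range_subset_range.mpr (Nat.le_succ n)) fun n _ _ => h0 n).trans ?_
  refine (sum_pow_mul_sum_le hr0 hr1 hA n).trans ?_
  refine mul_le_mul_of_nonneg_left ?_ (inv_nonneg.mpr (by linarith))
  exact hs.sum_le_tsum _ fun k _ => mul_nonneg (pow_nonneg hr0 _) (hA k)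

theorem summable_norm_scaledBeta {q : ℂ} (hq1 : ‖q‖ < 1) {α : ℕ → ℂ}
    (hs : Summable fun k => ‖q ^ ((k + 1).choose 2) * α k‖) :
    Summable fun n => ‖q ^ ((n + 1).choose 2) / qPoch q q n * scaledBeta q α n‖ := by
  obtain ⟨C, hC, h⟩ := exists_norm_scaledBeta_le hq1
  obtain ⟨D, hD, h'⟩ := exists_norm_inv_qPoch_le hq1 hq1
  have hs' := (summable_pow_mul_sum (norm_nonneg q) hq1 (A := fun k => C * ‖α k‖)
    (fun k => by positivity) ?_).mul_left D
  · refine hs'.of_nonneg_of_le (fun _ => norm_nonneg _) fun n => ?_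
    rw [norm_mul, div_eq_mul_inv, norm_mul, norm_pow, mul_comm (‖q‖ ^ _), mul_assoc]
    have := h' n; have := h α n
    gcongr
  · refine (hs.mul_left C).congr fun k => ?_
    rw [norm_mul, norm_pow]; ring

/-- The limiting case of the Bailey chain step. -/
theorem hasSum_scaledBeta {q : ℂ} (hq1 : ‖q‖ < 1) {α : ℕ → ℂ}
    (hs : Summable fun k => ‖q ^ ((k + 1).choose 2) * α k‖) :
    HasSum (fun n => q ^ ((n + 1).choose 2) / qPoch q q n * scaledBeta q α n)
      (qPochInf (-q) q / qPochInf q q * ((1 - q) * ∑' k, q ^ ((k + 1).choose 2) * α k)) := by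
  have hsum := summable_norm_scaledBeta hq1 hs
  obtain ⟨C, hC, h⟩ := exists_norm_inv_qPoch_le hq1 hq1
  obtain ⟨D, hD, h'⟩ := exists_norm_baileyKernel_le hq1
  have hshift : ∀ k : ℕ, Tendsto (fun N => N - k) atTop atTop := fun k => tendsto_sub_atTop_nat k
  have hinf := qPochInf_ne_zero hq1 hq1
  have hinf' := qPochInf_ne_zero hq1 (norm_sq_lt_one hq1)
  -- `h1` and `h2` are the limits of the two sides of `sum_beta_step`, which therefore agree.
  have h1 := tendsto_sum_range_mul hsum (c := fun N n => (qPoch q q (N - n))⁻¹)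
    (fun N k => h (N - k)) (fun k => (tendsto_inv_qPoch hq1 hq1).comp (hshift k))
  have h2 := (tendsto_qPoch hq1 (-q)).mul (tendsto_sum_range_mul hs (c := baileyKernel q)
    (l := (qPochInf q q)⁻¹ * (qPochInf (q * q) q)⁻¹) h' fun k => by
      refine (((tendsto_inv_qPoch hq1 hq1).comp (hshift k)).mul
        ((tendsto_inv_qPoch hq1 (norm_sq_lt_one hq1)).comp
          (tendsto_add_atTop_nat k))).congr' ?_
      filter_upwards [eventually_ge_atTop k] with N hN
      rw [baileyKernel, if_pos hN, one_div, mul_inv]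
      rfl)
  have h3 := tendsto_nhds_unique (h1.congr fun N => ?_) h2
  · have h4 : (1 - q) * qPochInf (q * q) q = qPochInf q q := by
      refine tendsto_nhds_unique ((tendsto_qPoch hq1 (q * q)).const_mul (1 - q)) ?_
      exact ((tendsto_qPoch hq1 q).comp (tendsto_add_atTop_nat 1)).congr fun n =>
        (one_sub_mul_qPoch q n).symm
    convert! hsum.of_norm.hasSum using 1
    rw [← h4] at h3 ⊢
    have hq : 1 - q ≠ 0 := by simpa using one_sub_pow_ne_zero hq1 0
    generalize 1 - q = y at *
    generalize qPochInf (q * q) q = z at *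
    field_simp at h3 ⊢
    exact h3.symm
  · rw [← sum_beta_step hq1 α N]
    refine Finset.sum_congr rfl fun n _ => ?_
    rw [scaledBeta]
    have := qPoch_self_ne_zero hq1 n
    field_simp

/-! ### Tuples and the weights of the multisum -/

theorem entry_cons_one {m : ℕ} (x : ℕ) (n : Fin m → ℕ) :
    entry (Fin.cons x n : Fin (m + 1) → ℕ) 1 = x := by
  rw [entry, dif_pos (by omega)]
  rfl

theorem entry_cons_succ {m : ℕ} (x : ℕ) (n : Fin m → ℕ) {i : ℕ} (hi : 1 ≤ i) :
    entry (Fin.cons x n : Fin (m + 1) → ℕ) (i + 1) = entry n i := by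
  obtain ⟨i, rfl⟩ := Nat.exists_eq_add_of_le' hi
  by_cases h : i + 1 ≤ m
  · rw [entry, entry, dif_pos (by omega), dif_pos (by omega)]
    rfl
  · rw [entry, entry, dif_neg (by omega), dif_neg (by omega)]

theorem kdelta_succ_succ (i j : ℕ) : kdelta (i + 1) (j + 1) = kdelta i j := by
  simp [kdelta]

theorem Icc_one_succ_eq_cons (m : ℕ) :
    Finset.Icc 1 (m + 1) = insert 1 ((Finset.Icc 1 m).image (· + 1)) := by
  ext i
  simp only [Finset.mem_Icc, Finset.mem_insert, Finset.mem_image]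
  constructor
  · intro h
    rcases Nat.lt_or_ge 1 i with h1 | h1
    · exact Or.inr ⟨i - 1, by omega, by omega⟩
    · exact Or.inl (by omega)
  · rintro (rfl | ⟨j, hj, rfl⟩) <;> omega

theorem sum_Icc_one_succ {M : Type*} [AddCommMonoid M] (g : ℕ → M) (m : ℕ) :
    ∑ i ∈ Finset.Icc 1 (m + 1), g i = g 1 + ∑ i ∈ Finset.Icc 1 m, g (i + 1) := by
  rw [Icc_one_succ_eq_cons, Finset.sum_insert (by simp), Finset.sum_image (by simp)]

theorem prod_Icc_one_succ {M : Type*} [CommMonoid M] (g : ℕ → M) (m : ℕ) :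
    ∏ i ∈ Finset.Icc 1 (m + 1), g i = g 1 * ∏ i ∈ Finset.Icc 1 m, g (i + 1) := by
  rw [Icc_one_succ_eq_cons, Finset.prod_insert (by simp), Finset.prod_image (by simp)]

/-- The factor of the summand of the multisum that does not involve `β`. -/
noncomputable def chainWeight (q : ℂ) (m a : ℕ) (n : Fin m → ℕ) : ℂ :=
  q ^ (∑ i ∈ Finset.Icc 1 m, (entry n i + 1).choose 2) / qPoch q q (entry n m)
    * ∏ i ∈ Finset.Icc 1 (m - 1), qBinom q (entry n (i + 1) + kdelta a i) (entry n i)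

theorem multisumTerm_eq (q : ℂ) (β : ℕ → ℂ) (m a : ℕ) (n : Fin m → ℕ) :
    multisumTerm q β m a n = chainWeight q m a n
      * (qPoch (q ^ 2) (q ^ 2) (entry n 1 + kdelta a 0) * β (entry n 1 + kdelta a 0)) := by
  rw [multisumTerm, chainWeight]
  ring

theorem chainWeight_one (q : ℂ) (a : ℕ) (n : Fin 1 → ℕ) :
    chainWeight q 1 a n = q ^ ((entry n 1 + 1).choose 2) / qPoch q q (entry n 1) := by
  simp [chainWeight]

/-- The q-binomials only involve δ_{a,i} with 1 ≤ i ≤ m - 1, all zero for a = 0 and for a = m. -/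
theorem chainWeight_zero_eq (q : ℂ) (m : ℕ) (n : Fin m → ℕ) :
    chainWeight q m 0 n = chainWeight q m m n := by
  rw [chainWeight, chainWeight]
  congr 1
  refine Finset.prod_congr rfl fun i hi => ?_
  have := Finset.mem_Icc.mp hi
  rw [kdelta, kdelta, if_neg (by omega), if_neg (by omega)]

/-- Removing n_1 = x lowers m and a together: the delta attached to the new first entry becomes
δ_{a,0}, as the induction requires. -/
theorem chainWeight_cons (q : ℂ) (m a : ℕ) (x : ℕ) (n : Fin (m + 1) → ℕ) :
    chainWeight q (m + 2) (a + 1) (Fin.cons x n : Fin (m + 2) → ℕ)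
      = chainWeight q (m + 1) a n
        * (q ^ ((x + 1).choose 2) * qBinom q (entry n 1 + kdelta a 0) x) := by
  rw [chainWeight, chainWeight, sum_Icc_one_succ, show m + 2 - 1 = m + 1 by rfl,
    prod_Icc_one_succ, entry_cons_one, entry_cons_succ x n (i := m + 1) (by omega),
    entry_cons_succ x n le_rfl, kdelta_succ_succ, pow_add, Nat.add_sub_cancel]
  have h1 : ∑ i ∈ Finset.Icc 1 (m + 1),
      (entry (Fin.cons x n : Fin (m + 2) → ℕ) (i + 1) + 1).choose 2
      = ∑ i ∈ Finset.Icc 1 (m + 1), (entry n i + 1).choose 2 :=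
    Finset.sum_congr rfl fun i hi => by rw [entry_cons_succ x n (Finset.mem_Icc.mp hi).1]
  have h2 : ∏ i ∈ Finset.Icc 1 m,
      qBinom q (entry (Fin.cons x n : Fin (m + 2) → ℕ) (i + 1 + 1) + kdelta (a + 1) (i + 1))
        (entry (Fin.cons x n : Fin (m + 2) → ℕ) (i + 1))
      = ∏ i ∈ Finset.Icc 1 m, qBinom q (entry n (i + 1) + kdelta a i) (entry n i) :=
    Finset.prod_congr rfl fun i hi => by
      rw [entry_cons_succ x n (Finset.mem_Icc.mp hi).1, entry_cons_succ x n (by omega),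
        kdelta_succ_succ]
  rw [h1, h2]
  ring

/-- Splitting off the first entry of a tuple. -/
def tupleEquiv (m : ℕ) : (Fin m → ℕ) × ℕ ≃ (Fin (m + 1) → ℕ) :=
  (Equiv.prodComm _ _).trans (Fin.consEquiv fun _ => ℕ)

theorem tupleEquiv_apply (m : ℕ) (n : Fin m → ℕ) (x : ℕ) :
    tupleEquiv m (n, x) = Fin.cons x n := rfl

theorem hasSum_range_of_eq_zero {M : Type*} [AddCommMonoid M] [TopologicalSpace M] {g : ℕ → M}
    {N : ℕ} (hg : ∀ x, N < x → g x = 0) : HasSum g (∑ x ∈ Finset.range (N + 1), g x) :=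
  hasSum_sum_of_ne_finset_zero fun x hx => hg x (by simpa using hx)

/-! ### Absolute convergence of the multisum -/

theorem summable_chainWeight_one {q : ℂ} (hq1 : ‖q‖ < 1) (a : ℕ) {A G : ℕ → ℝ}
    (hA : ∀ k, 0 ≤ A k) (hG0 : ∀ N, 0 ≤ G N) (hG : ∀ N, G N ≤ ∑ k ∈ Finset.range (N + 1), A k)
    (hs : Summable fun k => ‖q‖ ^ ((k + 1).choose 2) * A k) :
    Summable fun n : Fin 1 → ℕ => ‖chainWeight q 1 a n‖ * G (entry n 1) := by
  obtain ⟨D, hD, h'⟩ := exists_norm_inv_qPoch_le hq1 hq1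
  have h := (summable_pow_mul_sum (norm_nonneg q) hq1 hA hs).mul_left D
  have hfun : ∀ n : Fin 1 → ℕ, entry n 1 = Equiv.funUnique (Fin 1) ℕ n := fun n => by
    rw [entry, dif_pos (by omega)]
    rfl
  refine .of_nonneg_of_le (fun n => mul_nonneg (norm_nonneg _) (hG0 _)) (fun n => ?_)
    ((Equiv.funUnique (Fin 1) ℕ).summable_iff.mpr h)
  rw [chainWeight_one, Function.comp, ← hfun, div_eq_mul_inv, norm_mul, norm_pow,
    mul_comm (‖q‖ ^ _), mul_assoc]
  have := h' (entry n 1); have := hG (entry n 1); have := hG0 (entry n 1)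
  gcongr

/-- `G` stands for |B_N| and keeps only its domination by partial sums of `A`. That property
survives summing out n_1, which replaces A_k by a constant times |q|^{C(k+1,2)} A_k. -/
theorem summable_chainWeight {q : ℂ} (hq1 : ‖q‖ < 1) (m : ℕ) : ∀ (a : ℕ), a ≤ m + 1 →
    ∀ (A G : ℕ → ℝ), (∀ k, 0 ≤ A k) → (∀ N, 0 ≤ G N) →
    (∀ N, G N ≤ ∑ k ∈ Finset.range (N + 1), A k) →
    (Summable fun k => ‖q‖ ^ ((m + 1) * k.choose 2 + a * k) * A k) →
    Summable fun n : Fin (m + 1) → ℕ =>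
      ‖chainWeight q (m + 1) a n‖ * G (entry n 1 + kdelta a 0) := by
  have reduce : ∀ m, (∀ (A G : ℕ → ℝ), (∀ k, 0 ≤ A k) → (∀ N, 0 ≤ G N) →
      (∀ N, G N ≤ ∑ k ∈ Finset.range (N + 1), A k) →
      (Summable fun k => ‖q‖ ^ ((m + 1) * k.choose 2 + (m + 1) * k) * A k) →
      Summable fun n : Fin (m + 1) → ℕ =>
        ‖chainWeight q (m + 1) (m + 1) n‖ * G (entry n 1 + kdelta (m + 1) 0)) →
      ∀ (A G : ℕ → ℝ), (∀ k, 0 ≤ A k) → (∀ N, 0 ≤ G N) →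
      (∀ N, G N ≤ ∑ k ∈ Finset.range (N + 1), A k) →
      (Summable fun k => ‖q‖ ^ ((m + 1) * k.choose 2 + 0 * k) * A k) →
      Summable fun n : Fin (m + 1) → ℕ =>
        ‖chainWeight q (m + 1) 0 n‖ * G (entry n 1 + kdelta 0 0) := by
    intro m H A G hA hG0 hG hs
    -- For a = 0 the delta is absorbed by shifting `G` and `A`; the lost term A 0 is put back at
    -- index 0.
    have h := H (fun k => A (k + 1) + if k = 0 then A 0 else 0) (fun N => G (N + 1))
      (fun k => add_nonneg (hA _) (by split_ifs <;> simp [hA])) (fun N => hG0 _) (fun N => ?_) ?_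
    · exact h.congr fun n => by rw [chainWeight_zero_eq]; rfl
    · refine (hG (N + 1)).trans (le_of_eq ?_)
      rw [Finset.sum_range_succ', Finset.sum_add_distrib, Finset.sum_ite_eq' _ 0]
      simp
    · simp only [mul_add]
      refine Summable.add ?_ ?_
      · refine ((summable_nat_add_iff 1).mpr hs).congr fun k => ?_
        rw [Nat.choose_succ_succ' k 1, Nat.choose_one_right]
        ring
      · refine summable_of_ne_finset_zero (s := {0}) fun k hk => ?_
        rw [if_neg (by simpa using hk), mul_zero]
  induction m with
  | zero =>
    have key : ∀ (A G : ℕ → ℝ), (∀ k, 0 ≤ A k) → (∀ N, 0 ≤ G N) →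
        (∀ N, G N ≤ ∑ k ∈ Finset.range (N + 1), A k) →
        (Summable fun k => ‖q‖ ^ ((0 + 1) * k.choose 2 + (0 + 1) * k) * A k) →
        Summable fun n : Fin (0 + 1) → ℕ =>
          ‖chainWeight q (0 + 1) (0 + 1) n‖ * G (entry n 1 + kdelta (0 + 1) 0) := by
      intro A G hA hG0 hG hs
      refine summable_chainWeight_one hq1 1 hA hG0 hG (hs.congr fun k => ?_)
      rw [Nat.choose_succ_succ' k 1, Nat.choose_one_right]
      ring
    intro a ha
    rcases a with _ | a
    · exact reduce 0 key
    · obtain rfl : a = 0 := by omega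
      exact key
  | succ m ih =>
    have key : ∀ a ≤ m + 1, ∀ (A G : ℕ → ℝ), (∀ k, 0 ≤ A k) → (∀ N, 0 ≤ G N) →
        (∀ N, G N ≤ ∑ k ∈ Finset.range (N + 1), A k) →
        (Summable fun k => ‖q‖ ^ ((m + 1 + 1) * k.choose 2 + (a + 1) * k) * A k) →
        Summable fun n : Fin (m + 1 + 1) → ℕ =>
          ‖chainWeight q (m + 1 + 1) (a + 1) n‖ * G (entry n 1 + kdelta (a + 1) 0) := by
      intro a ha A G hA hG0 hG hs
      obtain ⟨C, hC, hCb⟩ := exists_norm_qBinom_le hq1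
      have hr : 0 ≤ (1 - ‖q‖)⁻¹ := inv_nonneg.mpr (by linarith)
      set G' : ℕ → ℝ := fun N => ∑ x ∈ Finset.range (N + 1),
        ‖q ^ ((x + 1).choose 2) * qBinom q N x‖ * G x with hG'
      -- `C` bounds the q-binomials, and (1 - ‖q‖)⁻¹ comes from `sum_pow_mul_sum_le`.
      have h := ih a ha (fun k => C * (1 - ‖q‖)⁻¹ * (‖q‖ ^ ((k + 1).choose 2) * A k)) G'
        (fun k => mul_nonneg (by positivity) (mul_nonneg (by positivity) (hA k)))
        (fun N => Finset.sum_nonneg fun x _ => mul_nonneg (norm_nonneg _) (hG0 x))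
        (fun N => ?_) ?_
      · rw [← (tupleEquiv (m + 1)).summable_iff]
        have hfib : ∀ n : Fin (m + 1) → ℕ, HasSum (fun x =>
            ((fun n : Fin (m + 1 + 1) → ℕ =>
              ‖chainWeight q (m + 1 + 1) (a + 1) n‖ * G (entry n 1 + kdelta (a + 1) 0))
              ∘ tupleEquiv (m + 1)) (n, x))
            (‖chainWeight q (m + 1) a n‖ * G' (entry n 1 + kdelta a 0)) := by
          intro n
          have hf : ∀ x, ((fun n : Fin (m + 1 + 1) → ℕ =>
              ‖chainWeight q (m + 1 + 1) (a + 1) n‖ * G (entry n 1 + kdelta (a + 1) 0))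
              ∘ tupleEquiv (m + 1)) (n, x) = ‖chainWeight q (m + 1) a n‖
              * (‖q ^ ((x + 1).choose 2) * qBinom q (entry n 1 + kdelta a 0) x‖ * G x) := by
            intro x
            rw [Function.comp, tupleEquiv_apply, chainWeight_cons, entry_cons_one, norm_mul,
              mul_assoc]
            rfl
          simp only [hf]
          refine (hasSum_range_of_eq_zero fun x hx => ?_).mul_left _
          rw [qBinom_of_lt hx, mul_zero, norm_zero, zero_mul]
        exact (summable_prod_of_nonneg (fun p => mul_nonneg (norm_nonneg _) (hG0 _))).mpr
          ⟨fun n => (hfib n).summable, h.congr fun n => (hfib n).tsum_eq.symm⟩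
      · rw [hG', ← Finset.mul_sum, mul_assoc]
        refine le_trans ?_ (mul_le_mul_of_nonneg_left
          (sum_pow_mul_sum_le (norm_nonneg q) hq1 hA N) hC)
        rw [Finset.mul_sum]
        refine Finset.sum_le_sum fun x _ => ?_
        rw [norm_mul, norm_pow, mul_comm (‖q‖ ^ _), mul_assoc]
        have := hCb N x; have := hG x; have := hG0 x
        gcongr
      · refine (hs.mul_left (C * (1 - ‖q‖)⁻¹)).congr fun k => ?_
        rw [Nat.choose_succ_succ' k 1, Nat.choose_one_right]
        ring
    intro a ha
    rcases a with _ | a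
    · exact reduce (m + 1) (key (m + 1) le_rfl)
    · exact key a (by omega)

/-! ### Evaluation of the multisum -/

theorem hasSum_chainWeight_succ {q : ℂ} (hq1 : ‖q‖ < 1) {m a : ℕ} {α : ℕ → ℂ} {s : ℂ}
    (ha : a ≤ m + 1)
    (hα : Summable fun k => ‖q ^ ((m + 2) * k.choose 2 + (a + 1) * k) * α k‖)
    (h : HasSum (fun n : Fin (m + 1) → ℕ => chainWeight q (m + 1) a n
      * scaledBeta q (fun k => q ^ ((k + 1).choose 2) * α k) (entry n 1 + kdelta a 0)) s) :
    HasSum (fun n : Fin (m + 2) → ℕ => chainWeight q (m + 2) (a + 1) n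
      * scaledBeta q α (entry n 1 + kdelta (a + 1) 0)) s := by
  obtain ⟨C, hC, hb⟩ := exists_norm_scaledBeta_le hq1
  have hsum : Summable fun n : Fin (m + 2) → ℕ => chainWeight q (m + 2) (a + 1) n
      * scaledBeta q α (entry n 1 + kdelta (a + 1) 0) := by
    refine Summable.of_norm ((summable_chainWeight hq1 (m + 1) (a + 1) (by omega)
      (fun k => C * ‖α k‖) (fun N => ‖scaledBeta q α N‖) (fun k => by positivity)
      (fun N => norm_nonneg _) (hb α) ?_).congr fun n => (norm_mul _ _).symm)
    refine (hα.mul_left C).congr fun k => ?_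
    rw [norm_mul, norm_pow]
    ring
  rw [← (tupleEquiv (m + 1)).summable_iff] at hsum
  rw [← (tupleEquiv (m + 1)).hasSum_iff]
  -- Summability is known, so summing along the fibres identifies the value. Each fibre, a sum over
  -- n_1, is finite and is a chain step.
  refine (hsum.hasSum.prod_fiberwise (fun n => ?_)).unique h ▸ hsum.hasSum
  have hf : ∀ x, ((fun n : Fin (m + 2) → ℕ => chainWeight q (m + 2) (a + 1) n
      * scaledBeta q α (entry n 1 + kdelta (a + 1) 0)) ∘ tupleEquiv (m + 1)) (n, x)
      = chainWeight q (m + 1) a n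
        * (q ^ ((x + 1).choose 2) * qBinom q (entry n 1 + kdelta a 0) x * scaledBeta q α x) := by
    intro x
    rw [Function.comp, tupleEquiv_apply, chainWeight_cons, entry_cons_one, mul_assoc]
    rfl
  simp only [hf]
  rw [← sum_scaledBeta hq1]
  refine (hasSum_range_of_eq_zero fun x hx => ?_).mul_left _
  rw [qBinom_of_lt hx, mul_zero, zero_mul]

/-- The case `a = m`, for an arbitrary Bailey pair. -/
theorem hasSum_chainWeight_self {q : ℂ} (hq1 : ‖q‖ < 1) (m : ℕ) : ∀ (α : ℕ → ℂ),
    (Summable fun k => ‖q ^ ((m + 1) * (k + 1).choose 2) * α k‖) →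
    HasSum (fun n : Fin (m + 1) → ℕ => chainWeight q (m + 1) (m + 1) n
      * scaledBeta q α (entry n 1))
      (qPochInf (-q) q / qPochInf q q
        * ((1 - q) * ∑' k, q ^ ((m + 1) * (k + 1).choose 2) * α k)) := by
  induction m with
  | zero =>
    intro α hα
    simp only [zero_add, one_mul] at hα ⊢
    rw [← (Equiv.funUnique (Fin 1) ℕ).symm.hasSum_iff]
    convert! hasSum_scaledBeta hq1 hα using 2 with n
    rw [Function.comp, chainWeight_one]
    rfl
  | succ m ih =>
    intro α hα
    refine hasSum_chainWeight_succ (a := m + 1) hq1 le_rfl (hα.congr fun k => ?_) ?_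
    · rw [Nat.choose_succ_succ' k 1, Nat.choose_one_right]
      ring_nf
    · have h : ∀ k, q ^ ((m + 1 + 1) * (k + 1).choose 2) * α k
          = q ^ ((m + 1) * (k + 1).choose 2) * (q ^ ((k + 1).choose 2) * α k) := fun k => by ring
      simp only [h] at hα ⊢
      exact ih _ hα

theorem choose_two_succ (k : ℕ) : (k + 1).choose 2 = k.choose 2 + k := by
  rw [Nat.choose_succ_succ' k 1, Nat.choose_one_right, add_comm]

theorem summable_norm_pow_mul {q : ℂ} (hq1 : ‖q‖ < 1) {t : ℕ → ℂ} (ht : Summable fun k => ‖t k‖)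
    (e : ℕ → ℕ) : Summable fun k => ‖q ^ e k * t k‖ := by
  refine ht.of_nonneg_of_le (fun _ => norm_nonneg _) fun k => ?_
  rw [norm_mul, norm_pow]
  exact mul_le_of_le_one_left (norm_nonneg _) (pow_le_one₀ (norm_nonneg _) hq1.le)

/-- Each F_j occurs at k = j - 1 and at k = j + 1. Since C(j+2,2) = C(j,2) + 2j + 1, the second
occurrence is -q^{(m+1)(2j+1)} times the first. -/
theorem hasSum_shiftedAlpha {q : ℂ} (hq1 : ‖q‖ < 1) (m : ℕ) {F : ℕ → ℂ}
    (hF : Summable fun k => ‖q ^ (m * k.choose 2) * F k‖) :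
    HasSum (fun k => q ^ (m * (k + 1).choose 2) * ((1 - q) * shiftedAlpha q F k))
      (∑' k, (1 - q ^ ((m + 1) * (2 * k + 1))) * (q ^ (m * k.choose 2) * F k))
    ∧ Summable fun k => ‖q ^ (m * (k + 1).choose 2) * shiftedAlpha q F k‖ := by
  have hq : 1 - q ≠ 0 := by simpa using one_sub_pow_ne_zero hq1 0
  have hF2 := summable_norm_pow_mul hq1 hF fun k => (m + 1) * (2 * k + 1)
  -- `w` at 0 supplies the F 0 missing from the shifted first occurrences.
  let w : ℕ → ℂ := fun k => Nat.casesOn k (F 0)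
    fun j => -(q ^ ((m + 1) * (2 * j + 1)) * (q ^ (m * j.choose 2) * F j))
  have hk : ∀ k, q ^ (m * (k + 1).choose 2) * ((1 - q) * shiftedAlpha q F k)
      = q ^ (m * (k + 1).choose 2) * F (k + 1) + w k := by
    intro k
    rcases k with _ | k
    · simp only [w, shiftedAlpha]
      rw [mul_div_cancel₀ _ hq]
      simp
    · simp only [w, shiftedAlpha]
      rw [mul_div_cancel₀ _ hq, choose_two_succ (k + 1), choose_two_succ k]
      ring
  have h1 : HasSum (fun k => q ^ (m * (k + 1).choose 2) * F (k + 1))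
      ((∑' k, q ^ (m * k.choose 2) * F k) - F 0) := by
    have := (hasSum_nat_add_iff' 1).mpr hF.of_norm.hasSum
    simpa using this
  have h2 : HasSum w (-(∑' k, q ^ ((m + 1) * (2 * k + 1)) * (q ^ (m * k.choose 2) * F k)) + F 0) := by
    have := (hasSum_nat_add_iff (f := w) 1).mp hF2.of_norm.hasSum.neg
    simpa [w] using this
  constructor
  · simp only [hk]
    convert! h1.add h2 using 1
    simp only [sub_mul, one_mul]
    rw [hF.of_norm.tsum_sub hF2.of_norm]
    ring
  · have hw : Summable fun k => ‖w k‖ := by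
      refine (summable_nat_add_iff 1).mp (hF2.congr fun k => ?_)
      simp only [w, norm_neg]
    have h3 := ((((summable_nat_add_iff 1).mpr hF).add hw).mul_left ‖(1 - q)⁻¹‖)
    refine h3.of_nonneg_of_le (fun _ => norm_nonneg _) fun k => ?_
    rw [show q ^ (m * (k + 1).choose 2) * shiftedAlpha q F k
      = (1 - q)⁻¹ * (q ^ (m * (k + 1).choose 2) * F (k + 1) + w k) by
        rw [← hk]; field_simp, norm_mul]
    exact mul_le_mul_of_nonneg_left (norm_add_le _ _) (norm_nonneg _)

theorem hasSum_chainWeight {q : ℂ} (hq1 : ‖q‖ < 1) (a : ℕ) : ∀ (m : ℕ), a ≤ m + 1 →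
    ∀ (F : ℕ → ℂ), (Summable fun k => ‖q ^ ((m + 1) * k.choose 2 + a * k) * F k‖) →
    HasSum (fun n : Fin (m + 1) → ℕ => chainWeight q (m + 1) a n
      * scaledBeta q (fun k => (1 - q ^ (2 * k + 1)) / (1 - q) * F k) (entry n 1 + kdelta a 0))
      (qPochInf (-q) q / qPochInf q q * ∑' k, (1 - q ^ ((m + 2 - a) * (2 * k + 1)))
        * (q ^ ((m + 1) * k.choose 2 + a * k) * F k)) := by
  have hq : 1 - q ≠ 0 := by simpa using one_sub_pow_ne_zero hq1 0
  induction a with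
  | zero =>
    intro m _ F hF
    simp only [zero_mul, add_zero, Nat.sub_zero] at hF ⊢
    obtain ⟨h1, h2⟩ := hasSum_shiftedAlpha hq1 (m + 1) hF
    have h3 := hasSum_chainWeight_self hq1 m _ h2
    rw [← h1.tsum_eq]
    convert! h3 using 2 with n
    · rw [chainWeight_zero_eq, show kdelta 0 0 = 1 from rfl, scaledBeta_succ hq1]
    · rw [← tsum_mul_left]
      exact tsum_congr fun k => by ring
  | succ a ih =>
    intro m ha F hF
    -- If a < m, removing n_1 leaves a nonempty tuple with a lowered. Otherwise a + 1 = m + 1: no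
    -- delta is active and no shift is needed.
    rcases Nat.lt_or_ge a m with h | h
    · obtain ⟨m, rfl⟩ : ∃ m', m = m' + 1 := ⟨m - 1, by omega⟩
      have he : ∀ k, q ^ ((m + 2) * k.choose 2 + (a + 1) * k) * F k
          = q ^ ((m + 1) * k.choose 2 + a * k) * (q ^ ((k + 1).choose 2) * F k) := fun k => by
        rw [choose_two_succ]; ring
      refine hasSum_chainWeight_succ hq1 (by omega) ?_ ?_
      · have h4 := ((hF.add (summable_norm_pow_mul hq1 hF fun k => 2 * k + 1)).mul_left
          ‖(1 - q)⁻¹‖)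
        refine h4.of_nonneg_of_le (fun _ => norm_nonneg _) fun k => ?_
        rw [show q ^ ((m + 2) * k.choose 2 + (a + 1) * k)
          * ((1 - q ^ (2 * k + 1)) / (1 - q) * F k)
          = (1 - q)⁻¹ * (q ^ ((m + 2) * k.choose 2 + (a + 1) * k) * F k
            - q ^ (2 * k + 1) * (q ^ ((m + 2) * k.choose 2 + (a + 1) * k) * F k)) by
            field_simp, norm_mul]
        exact mul_le_mul_of_nonneg_left (norm_sub_le _ _) (norm_nonneg _)
      · have h5 := ih m (by omega) (fun k => q ^ ((k + 1).choose 2) * F k)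
          (hF.congr fun k => by rw [← he])
        rw [show m + 1 + 2 - (a + 1) = m + 2 - a by omega]
        simp only [he, show m + 1 + 1 = m + 2 from rfl]
        convert! h5 using 4 with n
        funext k
        ring
    · obtain rfl : m = a := by omega
      have he : ∀ k, q ^ ((m + 1) * (k + 1).choose 2) * ((1 - q ^ (2 * k + 1)) / (1 - q) * F k)
          = (1 - q)⁻¹ * ((1 - q ^ (2 * k + 1)) * (q ^ ((m + 1) * k.choose 2 + (m + 1) * k) * F k)) :=
        fun k => by rw [choose_two_succ]; field_simp; ring
      have h1 := hasSum_chainWeight_self hq1 m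
        (fun k => (1 - q ^ (2 * k + 1)) / (1 - q) * F k) ?_
      · convert! h1 using 2
        rw [tsum_congr he, tsum_mul_left, mul_inv_cancel_left₀ hq, show m + 2 - (m + 1) = 1 by omega]
        simp only [one_mul]
      · have h4 := ((hF.add (summable_norm_pow_mul hq1 hF fun k => 2 * k + 1)).mul_left
          ‖(1 - q)⁻¹‖)
        refine h4.of_nonneg_of_le (fun _ => norm_nonneg _) fun k => ?_
        rw [he, norm_mul, sub_mul, one_mul]
        exact mul_le_mul_of_nonneg_left (norm_sub_le _ _) (norm_nonneg _)

/-! ### The bilateral series -/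

theorem thetaTerm_natCast (q : ℂ) (f : ℤ → ℂ) (m a n : ℕ) :
    thetaTerm q f m a n = q ^ (m * n.choose 2 + a * n) * f n := by
  have h : (n : ℤ) * (n - 1) / 2 = (n.choose 2 : ℕ) := by
    rw [Nat.choose_two_right]
    rcases n with _ | n
    · simp
    · push_cast
      simp
  rw [thetaTerm, h]
  congr 1

/-- The hypothesis on f amounts to f_{-n-1} = -q^{2n+1} f_n, and C(-n-1,2) = C(n+2,2). Pairing n
with -n-1 thus yields the factor 1 - q^{(m+1-a)(2n+1)}. -/
theorem thetaTerm_neg {q : ℂ} (hq0 : q ≠ 0) {f : ℤ → ℂ}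
    (hf : ∀ n : ℤ, q ^ n * f n = -(q ^ (-n - 1) * f (-n - 1))) {m a : ℕ} (ha : a ≤ m) (n : ℕ) :
    thetaTerm q f m a (-(n + 1))
      = -(q ^ ((m + 1 - a) * (2 * n + 1)) * (q ^ (m * n.choose 2 + a * n) * f n)) := by
  obtain ⟨d, rfl⟩ := Nat.exists_eq_add_of_le ha
  have h : (-((n : ℤ) + 1)) * (-((n : ℤ) + 1) - 1) / 2 = ((n + 2).choose 2 : ℕ) := by
    rw [Nat.choose_two_right, show n + 2 - 1 = n + 1 by omega]
    push_cast
    congr 1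
    ring
  have hfn : f (-(n + 1)) = -(q ^ (2 * (n : ℤ) + 1) * f n) := by
    have h1 := hf n
    rw [show -(n : ℤ) - 1 = -(n + 1) by ring] at h1
    rw [show 2 * (n : ℤ) + 1 = (n + 1) + n by ring, zpow_add₀ hq0, mul_assoc, h1, mul_neg, neg_neg,
      ← mul_assoc, ← zpow_add₀ hq0]
    simp
  rw [thetaTerm, h, hfn, mul_neg, ← mul_assoc, ← mul_assoc, ← zpow_add₀ hq0, ← pow_add,
    ← zpow_natCast, show a + d + 1 - a = d + 1 by omega, choose_two_succ (n + 1),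
    choose_two_succ n]
  congr 3
  push_cast
  ring

theorem theorem1p2 (q : ℂ) (hq0 : q ≠ 0) (hq1 : ‖q‖ < 1)
    (α β : ℕ → ℂ) (hαβ : IsBaileyPair q q α β)
    (f : ℤ → ℂ)
    (hα : ∀ n : ℕ, α n = (1 - q ^ (2 * n + 1)) / (1 - q) * f n)
    (hf : ∀ n : ℤ, q ^ n * f n = -(q ^ (-n - 1) * f (-n - 1)))
    (m a : ℕ) (hm : 1 ≤ m) (ha : a ≤ m)
    (hsum : Summable (thetaTerm q f m a)) :
    HasSum (multisumTerm q β m a)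
      (qPochInf (-q) q / qPochInf q q * ∑' n : ℤ, thetaTerm q f m a n) := by
  obtain ⟨m, rfl⟩ := Nat.exists_eq_add_of_le' hm
  have hF : Summable fun k : ℕ => ‖q ^ ((m + 1) * k.choose 2 + a * k) * f k‖ := by
    refine (hsum.norm.comp_injective Nat.cast_injective).congr fun k => ?_
    rw [Function.comp, thetaTerm_natCast]
  have h := hasSum_chainWeight hq1 a m ha (fun k => f k) hF
  have hF2 := summable_norm_pow_mul hq1 hF fun k => (m + 2 - a) * (2 * k + 1)
  have hθ : ∑' n : ℤ, thetaTerm q f (m + 1) a n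
      = ∑' k : ℕ, (1 - q ^ ((m + 2 - a) * (2 * k + 1)))
        * (q ^ ((m + 1) * k.choose 2 + a * k) * f k) := by
    refine (HasSum.of_nat_of_neg_add_one (f := thetaTerm q f (m + 1) a)
      (m := ∑' k : ℕ, q ^ ((m + 1) * k.choose 2 + a * k) * f k)
      (m' := -∑' k : ℕ, q ^ ((m + 2 - a) * (2 * k + 1))
        * (q ^ ((m + 1) * k.choose 2 + a * k) * f k)) ?_ ?_).tsum_eq.trans ?_
    · simp only [thetaTerm_natCast]
      exact hF.of_norm.hasSum
    · simp only [thetaTerm_neg hq0 hf ha]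
      exact hF2.of_norm.hasSum.neg
    · simp only [sub_mul, one_mul]
      rw [hF.of_norm.tsum_sub hF2.of_norm, sub_eq_add_neg]
  rw [hθ]
  convert! h using 2 with n
  rw [multisumTerm_eq, hαβ.scaledBeta_eq]
  simp only [← hα]
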